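/- Let $\mathbb{R}^n$ carry a norm $\|\cdot\|$, let matrices carry the induced operator norm, and write $\mathbb{R}_+=[0,\infty)$. Consider, for a real parameter $\varepsilon\ge 0$, the initial value problem $$\dot x=(A_0(t)+\varepsilon F(t))\,x+h(t,x,\varepsilon),\qquad x(t_0)=x_0, \tag{1}$$ where $A_0,F:\mathbb{R}_+\to\mathbb{R}^{n\times n}$ are continuous and $h:\mathbb{R}_+\times\mathbb{R}^n\times E\to\mathbb{R}^n$ for a parameter set $E\subseteq[0,\infty)$ (for instance $E=(0,\infty)$ or $E=[0,\infty)$). Assume: 1. $F$ is bounded; put $k=\sup_{t\ge0}\|F(t)\|$. 2. $\dot x=A_0(t)x$ is globally uniformly exponentially stable: there are $c,\gamma>0$ such that its state transition matrix (the solution of $\partial_tR_{A_0}(t,s)=A_0(t)R_{A_0}(t,s)$, $R_{A_0}(s,s)=I$) satisfies $\|R_{A_0}(t,s)\|\le c\,e^{-\gamma(t-s)}$ for all $t\ge s\ge0$. 3. $h$ is continuous in $(t,x,\varepsilon)$ and locally Lipschitz in $(x,\varepsilon)$, uniformly in $t$. 4. There are continuous functions $\phi\ge 0$ and $\lambda_\varepsilon\ge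 0$ ($\varepsilon\in E$) on $\mathbb{R}_+$ with $\|h(t,x,\varepsilon)\|\le\phi(t)\|x\|+\lambda_\varepsilon(t)$ for all $t\ge0$, $x\in\mathbb{R}^n$, $\varepsilon\in E$. 5. $\phi\in L^p(\mathbb{R}_+)$ for some $p\in[1,\infty)$. 6. With $\gamma_\varepsilon=\gamma-kc\,\varepsilon$, for each $\varepsilon\in E$ there is $M'>0$ with $\lambda_\varepsilon(t)\le M'e^{-\gamma_\varepsilon t}$ for all $t\ge0$. Then for every $\varepsilon\in E$ with $kc\,\varepsilon<\gamma$ (that is, $\varepsilon<\gamma/(kc)$, read as no restriction if $k=0$) there are constants $L,N\ge0$ and $\delta,\theta\in(0,\gamma_\varepsilon]$, independent of $t_0$ and $x_0$, such that for all $t_0\ge0$ and $x_0\in\mathbb{R}^n$ the problem (1) has exactly one maximal (forward in time) solution $x$, and (i) $x$ is defined on $[t_0,\infty)$; (ii) $\|x(t)\|\le L\|x_0\|e^{-\delta(t-t_0)}+N e^{-\theta t}$ for all $t\ge t_0$. -/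

import Mathlib

open Set Topology MeasureTheory
open scoped NNReal ENNReal

/-- `Φ` is the state transition matrix `t ↦ R_A(t, s)` (for `t ≥ s`) of the linear system
`x' = A(t) x`: the solution on `[s, ∞)` of `Φ' = A(t) Φ`, `Φ(s) = I`.
For continuous `A` it exists and is unique on `[s, ∞)`. -/
def IsTransitionMatrix {V : Type*} [NormedAddCommGroup V] [NormedSpace ℝ V]
    (A : ℝ → V →L[ℝ] V) (s : ℝ) (Φ : ℝ → V →L[ℝ] V) : Prop :=
  Φ s = ContinuousLinearMap.id ℝ V ∧
    ∀ t, s ≤ t → HasDerivWithinAt Φ ((A t).comp (Φ t)) (Ici s) t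

/-- The linear system `x' = A(t) x` is globally uniformly exponentially stable with constants
`c, γ > 0`: `‖R_A(t, s)‖ ≤ c e^{-γ (t - s)}` for all `t ≥ s ≥ 0` (operator norm). -/
def GloballyUniformlyExpStable {V : Type*} [NormedAddCommGroup V] [NormedSpace ℝ V]
    (A : ℝ → V →L[ℝ] V) (c γ : ℝ) : Prop :=
  0 < c ∧ 0 < γ ∧ ∀ s, 0 ≤ s → ∀ Φ : ℝ → V →L[ℝ] V, IsTransitionMatrix A s Φ →
    ∀ t, s ≤ t → ‖Φ t‖ ≤ c * Real.exp (-γ * (t - s))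

/-- `h(t, x, ε)` is locally Lipschitz in `(x, ε) ∈ V × E`, uniformly in `t ≥ 0`. -/
def LocallyLipschitzUniformlyInTime {V : Type*} [NormedAddCommGroup V]
    (E : Set ℝ) (h : ℝ → V → ℝ → V) : Prop :=
  ∀ x₀ : V, ∀ ε₀ ∈ E, ∃ K : ℝ≥0, ∃ U ∈ 𝓝[univ ×ˢ E] (x₀, ε₀),
    ∀ t : ℝ, 0 ≤ t → LipschitzOnWith K (fun q : V × ℝ => h t q.1 q.2) U

/-- `x` solves `x' = f(t, x)`, `x(t₀) = x₀` on the interval `I`, where `t₀` is the left endpoint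
of `I` and belongs to `I` (so `I = [t₀, T]`, `[t₀, T)` or `[t₀, ∞)`). -/
def IsSolutionOn {V : Type*} [NormedAddCommGroup V] [NormedSpace ℝ V]
    (f : ℝ → V → V) (t₀ : ℝ) (x₀ : V) (I : Set ℝ) (x : ℝ → V) : Prop :=
  I.OrdConnected ∧ IsLeast I t₀ ∧ x t₀ = x₀ ∧
    ∀ t ∈ I, HasDerivWithinAt x (f t (x t)) I t

/-- `x`, with domain `I`, is a maximal solution: no solution of the same initial value problem
on a larger interval extends it. -/
def IsMaximalSolution {V : Type*} [NormedAddCommGroup V] [NormedSpace ℝ V]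
    (f : ℝ → V → V) (t₀ : ℝ) (x₀ : V) (I : Set ℝ) (x : ℝ → V) : Prop :=
  IsSolutionOn f t₀ x₀ I x ∧
    ∀ (J : Set ℝ) (y : ℝ → V), IsSolutionOn f t₀ x₀ J y → I ⊆ J → EqOn y x I → J = I

/-! ### Global solutions under linear growth. -/

section ODE

variable {W : Type*} [NormedAddCommGroup W] [NormedSpace ℝ W]

/-! Both `ε F x` and `h` are treated as perturbations of the stable system `x' = A₀ x`. Variation of
constants (`GloballyUniformlyExpStable.norm_le`) for `u(t) = e^{γ t} ‖x(t)‖` gives `u(t) ≤ c e^{γ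
t₀} ‖x₀‖ + ∫ (c (ε k + φ) u + c e^{γ s} lam)`, and Grönwall (`le_mul_exp_of_le_integral`) bounds
`u`. The term `c ε k` lowers the decay rate from `γ` to `Γ = γ - k c ε > 0`. The term `c φ` costs an
arbitrarily small rate `η`, since an `L^p` function satisfies `∫ φ ≤ η (t - t₀) + C` with `C`
independent of `t₀` (`exists_integral_le_mul_add_of_memLp`). The forcing `lam` may decay exactly at
the rate `Γ`; this resonance produces a factor `t - t₀`, absorbed at the cost of a second `η`. Hence
the rates `Γ - η` and `Γ - 2 η`.

Linear growth excludes blow-up, so a solution exists on `[t₀, ∞)`. Lipschitz bounds on balls give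
uniqueness, and maximality then forces every maximal solution to be this global one. -/

lemma HasDerivWithinAt.Ici_of_Icc {x : ℝ → W} {x' : W} {a b t : ℝ}
    (h : HasDerivWithinAt x x' (Icc a b) t) (ht : t ∈ Ico a b) :
    HasDerivWithinAt x x' (Ici t) t :=
  (h.mono (Icc_subset_Icc_left ht.1)).mono_of_mem_nhdsWithin (Icc_mem_nhdsGE ht.2)

/-- Two solutions on `[a, b]` with the same initial value agree if the vector field is Lipschitz on
balls. -/
lemma eqOn_Icc_of_lipschitzOnWith_closedBall {f : ℝ → W → W} {a b : ℝ}
    (hlip : ∀ r : ℝ, ∃ K : ℝ≥0, ∀ t ∈ Icc a b, LipschitzOnWith K (f t) (Metric.closedBall 0 r))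
    {x y : ℝ → W} (hx : ∀ t ∈ Icc a b, HasDerivWithinAt x (f t (x t)) (Icc a b) t)
    (hy : ∀ t ∈ Icc a b, HasDerivWithinAt y (f t (y t)) (Icc a b) t) (hxy : x a = y a) :
    EqOn x y (Icc a b) := by
  have hxc : ContinuousOn x (Icc a b) := fun t ht => (hx t ht).continuousWithinAt
  have hyc : ContinuousOn y (Icc a b) := fun t ht => (hy t ht).continuousWithinAt
  obtain ⟨r₁, hr₁⟩ := isCompact_Icc.exists_bound_of_continuousOn hxc
  obtain ⟨r₂, hr₂⟩ := isCompact_Icc.exists_bound_of_continuousOn hyc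
  obtain ⟨K, hK⟩ := hlip (max r₁ r₂)
  refine ODE_solution_unique_of_mem_Icc_right (v := f) (K := K)
    (s := fun _ => Metric.closedBall 0 (max r₁ r₂))
    (fun t ht => hK t (Ico_subset_Icc_self ht)) hxc
    (fun t ht => (hx t (Ico_subset_Icc_self ht)).Ici_of_Icc ht) (fun t ht => ?_) hyc
    (fun t ht => (hy t (Ico_subset_Icc_self ht)).Ici_of_Icc ht) (fun t ht => ?_) hxy
  · simpa using Or.inl (hr₁ t (Ico_subset_Icc_self ht))
  · simpa using Or.inr (hr₂ t (Ico_subset_Icc_self ht))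

/-- A vector field of linear growth that is Lipschitz on balls has a solution on all of `[a, b]`. -/
lemma exists_hasDerivWithinAt_Icc_of_linear_growth [CompleteSpace W] {f : ℝ → W → W} {a b : ℝ}
    (hab : a ≤ b)
    (hlip : ∀ r : ℝ, ∃ K : ℝ≥0, ∀ t ∈ Icc a b, LipschitzOnWith K (f t) (Metric.closedBall 0 r))
    (hcont : ∀ x, ContinuousOn (fun t => f t x) (Icc a b))
    {α β : ℝ} (hα : 0 ≤ α) (hβ : 0 ≤ β)
    (hgrowth : ∀ t ∈ Icc a b, ∀ x, ‖f t x‖ ≤ α * ‖x‖ + β) (x₀ : W) :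
    ∃ x : ℝ → W, x a = x₀ ∧ ∀ t ∈ Icc a b, HasDerivWithinAt x (f t (x t)) (Icc a b) t := by
  -- A priori bound from the growth condition. The truncated field below obeys the same condition,
  -- so its solutions never leave the region where `χ = 1`.
  set R : ℝ := gronwallBound ‖x₀‖ α β (b - a)
  have hR0 : 0 ≤ R := by
    have h := gronwallBound_mono (norm_nonneg x₀) hβ hα (sub_nonneg.2 hab)
    rw [gronwallBound_x0] at h
    exact (norm_nonneg _).trans h
  -- truncate the vector field outside the ball of radius `R + 1`
  set χ : W → ℝ := fun x => max 0 (min 1 (R + 1 - ‖x‖)) with hχ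
  have hχ0 : ∀ x, 0 ≤ χ x := fun x => le_max_left _ _
  have hχ1 : ∀ x, χ x ≤ 1 := fun x => max_le zero_le_one (min_le_left _ _)
  have hχR : ∀ x, ‖x‖ ≤ R → χ x = 1 := fun x hx => by
    simp only [hχ]
    rw [min_eq_left (by linarith), max_eq_right zero_le_one]
  have hχR' : ∀ x, R + 1 ≤ ‖x‖ → χ x = 0 := fun x hx => by
    simp only [hχ]
    rw [max_eq_left ((min_le_right _ _).trans (by linarith))]
  have hχL : ∀ x y, |χ x - χ y| ≤ ‖x - y‖ := fun x y => by
    have h1 := abs_max_sub_max_le_abs (min 1 (R + 1 - ‖x‖)) (min 1 (R + 1 - ‖y‖)) 0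
    have h2 := abs_min_sub_min_le_max 1 (R + 1 - ‖x‖) 1 (R + 1 - ‖y‖)
    have h3 : |R + 1 - ‖x‖ - (R + 1 - ‖y‖)| ≤ ‖x - y‖ := by
      rw [show R + 1 - ‖x‖ - (R + 1 - ‖y‖) = ‖y‖ - ‖x‖ by ring, norm_sub_rev]
      exact abs_norm_sub_norm_le y x
    simp only [hχ]
    rw [max_comm 0, max_comm 0]
    refine h1.trans (h2.trans (max_le ?_ h3))
    simp
  have hbd : ∀ t ∈ Icc a b, ∀ x, ‖χ x • f t x‖ ≤ α * ‖x‖ + β := fun t ht x => by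
    rw [norm_smul, Real.norm_eq_abs, abs_of_nonneg (hχ0 x)]
    exact (mul_le_of_le_one_left (norm_nonneg _) (hχ1 x)).trans (hgrowth t ht x)
  -- The truncated field is bounded by `L` everywhere, so the Picard–Lindelöf radius `ρ = L (b - a)`
  -- covers all of `[a, b]` in one step.
  set L : ℝ≥0 := ⟨α * (R + 1) + β, by positivity⟩
  have hLc : (L : ℝ) = α * (R + 1) + β := rfl
  set ρ : ℝ≥0 := L * ⟨b - a, sub_nonneg.2 hab⟩
  obtain ⟨K, hK⟩ := hlip (‖x₀‖ + ρ)
  set M : ℝ≥0 := ⟨α * (‖x₀‖ + ρ) + β, by positivity⟩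
  have hMc : (M : ℝ) = α * (‖x₀‖ + ρ) + β := rfl
  have hball : ∀ x ∈ Metric.closedBall x₀ (ρ : ℝ), ‖x‖ ≤ ‖x₀‖ + ρ := fun x hx => by
    rw [mem_closedBall_iff_norm] at hx
    have := norm_le_norm_add_norm_sub' x x₀
    linarith
  have hPL : IsPicardLindelof (fun t x => χ x • f t x) (tmin := a) (tmax := b)
      ⟨a, left_mem_Icc.2 hab⟩ x₀ ρ 0 L (K + M) := by
    refine ⟨fun t ht => ?_, fun x _ => (hcont x).const_smul _, fun t ht x _ => ?_, ?_⟩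
    · refine LipschitzOnWith.of_dist_le_mul fun x hx y hy => ?_
      have hx' := hball x hx
      have hy' := hball y hy
      have h1 := (hK t ht).dist_le_mul x (by simpa using hx') y (by simpa using hy')
      have h2 := hgrowth t ht y
      rw [dist_eq_norm] at h1 ⊢
      rw [dist_eq_norm] at h1 ⊢
      have h3 : ‖f t y‖ ≤ M := h2.trans (by
        rw [hMc]
        gcongr)
      calc ‖χ x • f t x - χ y • f t y‖ = ‖χ x • (f t x - f t y) + (χ x - χ y) • f t y‖ := by
            rw [smul_sub, sub_smul]; congr 1; abel
        _ ≤ χ x * ‖f t x - f t y‖ + |χ x - χ y| * ‖f t y‖ := by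
            refine (norm_add_le _ _).trans ?_
            rw [norm_smul, norm_smul, Real.norm_eq_abs, Real.norm_eq_abs, abs_of_nonneg (hχ0 x)]
        _ ≤ 1 * (K * ‖x - y‖) + ‖x - y‖ * M := by
            gcongr
            · exact hχ1 x
            · exact hχL x y
        _ = _ := by push_cast; ring
    · rcases le_total ‖x‖ (R + 1) with h | h
      · refine (hbd t ht x).trans ?_
        rw [hLc]
        gcongr
      · simp only [hχR' x h, zero_smul, norm_zero]
        exact L.2
    · rw [show ((⟨a, left_mem_Icc.2 hab⟩ : Icc a b) : ℝ) = a from rfl, sub_self,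
        max_eq_left (sub_nonneg.2 hab)]
      rw [NNReal.coe_zero, sub_zero]
      exact le_rfl
  obtain ⟨x, hx0, hx⟩ := hPL.exists_eq_forall_mem_Icc_hasDerivWithinAt₀
  refine ⟨x, hx0, fun t ht => ?_⟩
  have hxR : ‖x t‖ ≤ R := by
    have h := norm_le_gronwallBound_of_norm_deriv_right_le (f := x)
      (fun t ht => (hx t ht).continuousWithinAt)
      (fun t ht => (hx t (Ico_subset_Icc_self ht)).Ici_of_Icc ht)
      (δ := ‖x₀‖) (K := α) (ε := β) (by rw [← hx0])
      (fun t ht => hbd t (Ico_subset_Icc_self ht) (x t)) t ht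
    exact h.trans (gronwallBound_mono (norm_nonneg _) hβ hα (by linarith [ht.2]))
  have h := hx t ht
  rwa [hχR _ hxR, one_smul] at h

/-- A vector field of linear growth that is Lipschitz on balls, locally uniformly in time, has a
solution on `[a, ∞)`. -/
lemma exists_hasDerivWithinAt_Ici_of_linear_growth [CompleteSpace W] {f : ℝ → W → W} {a : ℝ}
    (hlip : ∀ T r : ℝ, ∃ K : ℝ≥0, ∀ t ∈ Icc a T, LipschitzOnWith K (f t) (Metric.closedBall 0 r))
    (hcont : ∀ x, ContinuousOn (fun t => f t x) (Ici a))
    (hgrowth : ∀ T : ℝ, ∃ α β : ℝ, 0 ≤ α ∧ 0 ≤ β ∧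
      ∀ t ∈ Icc a T, ∀ x, ‖f t x‖ ≤ α * ‖x‖ + β) (x₀ : W) :
    ∃ x : ℝ → W, x a = x₀ ∧ ∀ t, a ≤ t → HasDerivWithinAt x (f t (x t)) (Ici a) t := by
  have hex : ∀ n : ℕ, ∃ x : ℝ → W, x a = x₀ ∧
      ∀ t ∈ Icc a (a + n), HasDerivWithinAt x (f t (x t)) (Icc a (a + n)) t := fun n => by
    obtain ⟨α, β, hα, hβ, h⟩ := hgrowth (a + n)
    exact exists_hasDerivWithinAt_Icc_of_linear_growth (by simp) (hlip _)
      (fun x => (hcont x).mono Icc_subset_Ici_self) hα hβ h x₀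
  choose y hy0 hy using hex
  have hagree : ∀ m n : ℕ, m ≤ n → EqOn (y m) (y n) (Icc a (a + m)) := fun m n hmn => by
    have hsub : Icc a (a + (m : ℝ)) ⊆ Icc a (a + n) :=
      Icc_subset_Icc_right (by gcongr)
    exact eqOn_Icc_of_lipschitzOnWith_closedBall (hlip _) (hy m)
      (fun t ht => (hy n t (hsub ht)).mono hsub) ((hy0 m).trans (hy0 n).symm)
  set N : ℝ → ℕ := fun t => ⌈t - a⌉₊
  have hNle : ∀ t, t ≤ a + N t := fun t => by linarith [Nat.le_ceil (t - a)]
  have hxy : ∀ n : ℕ, EqOn (fun t => y (N t) t) (y n) (Icc a (a + n)) := fun n t ht =>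
    hagree _ _ (Nat.ceil_le.2 (by linarith [ht.2])) ⟨ht.1, hNle t⟩
  refine ⟨fun t => y (N t) t, hy0 _, fun t ht => ?_⟩
  -- `N t + 1` instead of `N t` puts `t` strictly before the right endpoint, so the derivative
  -- within the compact interval is one within `Ici a`.
  have htlt : t < a + ((N t + 1 : ℕ) : ℝ) := by push_cast; linarith [hNle t]
  have htmem : t ∈ Icc a (a + ((N t + 1 : ℕ) : ℝ)) := ⟨ht, htlt.le⟩
  have h := (hy (N t + 1) t htmem).congr (hxy _) (hxy _ htmem)
  rw [← hxy _ htmem] at h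
  refine h.mono_of_mem_nhdsWithin ?_
  filter_upwards [self_mem_nhdsWithin, mem_nhdsWithin_of_mem_nhds (Iio_mem_nhds htlt)] with s h1 h2
  exact ⟨h1, le_of_lt h2⟩

end ODE

/-! ### Transition matrices and variation of constants. -/

section Linear

variable {W : Type*} [NormedAddCommGroup W] [NormedSpace ℝ W]

/-- A linear system with continuous coefficients has solutions on `[a, ∞)`. -/
lemma exists_hasDerivWithinAt_Ici_of_linear [CompleteSpace W] {B : ℝ → W →L[ℝ] W} {a : ℝ}
    (hB : ContinuousOn B (Ici a)) (x₀ : W) :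
    ∃ x : ℝ → W, x a = x₀ ∧ ∀ t, a ≤ t → HasDerivWithinAt x (B t (x t)) (Ici a) t := by
  have hbd : ∀ T : ℝ, ∃ C : ℝ≥0, ∀ t ∈ Icc a T, ‖B t‖ ≤ C := fun T => by
    obtain ⟨C, hC⟩ := isCompact_Icc.exists_bound_of_continuousOn
      (hB.mono (Icc_subset_Ici_self : Icc a T ⊆ Ici a))
    exact ⟨C.toNNReal, fun t ht => (hC t ht).trans (Real.le_coe_toNNReal C)⟩
  refine exists_hasDerivWithinAt_Ici_of_linear_growth (f := fun t x => B t x) (fun T r => ?_)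
    (fun x => hB.clm_apply continuousOn_const) (fun T => ?_) x₀
  · obtain ⟨C, hC⟩ := hbd T
    exact ⟨C, fun t ht => ((B t).lipschitz.weaken (hC t ht)).lipschitzOnWith⟩
  · obtain ⟨C, hC⟩ := hbd T
    refine ⟨C, 0, C.2, le_rfl, fun t ht x => ?_⟩
    rw [add_zero]
    exact (B t).le_of_opNorm_le (hC t ht) x

variable {V : Type*} [NormedAddCommGroup V] [NormedSpace ℝ V] [FiniteDimensional ℝ V]

/-- The transition matrix from time `0` exists and is invertible. -/
lemma exists_isTransitionMatrix_inverse {A : ℝ → V →L[ℝ] V} (hA : ContinuousOn A (Ici 0)) :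
    ∃ Φ Ψ : ℝ → V →L[ℝ] V, IsTransitionMatrix A 0 Φ ∧
      (∀ t, 0 ≤ t → HasDerivWithinAt Ψ (-(Ψ t).comp (A t)) (Ici 0) t) ∧
      ∀ t, 0 ≤ t → (Φ t).comp (Ψ t) = ContinuousLinearMap.id ℝ V := by
  have : CompleteSpace V := FiniteDimensional.complete ℝ V
  obtain ⟨Φ, hΦ0, hΦ⟩ := exists_hasDerivWithinAt_Ici_of_linear
    (B := fun t => ContinuousLinearMap.compL ℝ V V V (A t))
    ((ContinuousLinearMap.compL ℝ V V V).continuous.comp_continuousOn hA)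
    (ContinuousLinearMap.id ℝ V)
  -- The candidate inverse solves the adjoint equation `Ψ' = -Ψ A`, so that `(Ψ Φ)' = 0`.
  obtain ⟨Ψ, hΨ0, hΨ⟩ := exists_hasDerivWithinAt_Ici_of_linear
    (B := fun t => -(ContinuousLinearMap.compL ℝ V V V).flip (A t))
    (((ContinuousLinearMap.compL ℝ V V V).flip.continuous.comp_continuousOn hA).neg)
    (ContinuousLinearMap.id ℝ V)
  replace hΦ : ∀ t, 0 ≤ t → HasDerivWithinAt Φ ((A t).comp (Φ t)) (Ici 0) t := hΦ
  replace hΨ : ∀ t, 0 ≤ t → HasDerivWithinAt Ψ (-(Ψ t).comp (A t)) (Ici 0) t := hΨ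
  refine ⟨Φ, Ψ, ⟨hΦ0, hΦ⟩, hΨ, fun t ht => ?_⟩
  have hd : ∀ s, 0 ≤ s → HasDerivWithinAt (fun s => (Ψ s).comp (Φ s)) 0 (Ici 0) s := fun s hs => by
    refine ((hΨ s hs).clm_comp (hΦ s hs)).congr_deriv ?_
    ext v
    simp
  have hconst := constant_of_has_deriv_right_zero (f := fun s => (Ψ s).comp (Φ s)) (a := 0) (b := t)
    (fun s hs => ((hd s hs.1).continuousWithinAt).mono Icc_subset_Ici_self)
    (fun s hs => (hd s hs.1).mono (Ici_subset_Ici.2 hs.1)) t ⟨ht, le_rfl⟩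
  -- In finite dimension a left inverse is also a right inverse.
  have h1 : (Ψ t : V →ₗ[ℝ] V) * (Φ t : V →ₗ[ℝ] V) = 1 := by
    ext v
    simpa [hΦ0, hΨ0] using congrArg (fun T : V →L[ℝ] V => T v) hconst
  ext v
  simpa using congrArg (fun T : V →ₗ[ℝ] V => T v) (mul_eq_one_comm.1 h1)

/-- Variation of constants: bound on a solution of the inhomogeneous equation `x' = A x + g` for an
exponentially stable `A`. -/
lemma GloballyUniformlyExpStable.norm_le {A : ℝ → V →L[ℝ] V} {c γ : ℝ}
    (hstab : GloballyUniformlyExpStable A c γ) (hA : ContinuousOn A (Ici 0))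
    {t₀ : ℝ} (ht₀ : 0 ≤ t₀) {x g : ℝ → V} (hg : ContinuousOn g (Ici t₀))
    (hx : ∀ t, t₀ ≤ t → HasDerivWithinAt x (A t (x t) + g t) (Ici t₀) t) {t : ℝ} (ht : t₀ ≤ t) :
    ‖x t‖ ≤ c * Real.exp (-γ * (t - t₀)) * ‖x t₀‖ +
      ∫ s in t₀..t, c * Real.exp (-γ * (t - s)) * ‖g s‖ := by
  have : CompleteSpace V := FiniteDimensional.complete ℝ V
  obtain ⟨Φ, Ψ, ⟨-, hΦ⟩, hΨ, hΦΨ⟩ := exists_isTransitionMatrix_inverse hA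
  -- `r ↦ Φ(r) Ψ(s)` is the transition matrix started at `s`, so the stability bound applies to it.
  have hR : ∀ s, t₀ ≤ s → s ≤ t → ‖(Φ t).comp (Ψ s)‖ ≤ c * Real.exp (-γ * (t - s)) :=
    fun s hs hst => by
      have hs0 := ht₀.trans hs
      refine hstab.2.2 s hs0 (fun r => (Φ r).comp (Ψ s)) ⟨hΦΨ s hs0, fun r hr => ?_⟩ t hst
      refine (((hΦ r (hs0.trans hr)).mono (Ici_subset_Ici.2 hs0)).clm_comp
        (hasDerivWithinAt_const r (Ici s) (Ψ s))).congr_deriv ?_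
      ext v
      simp
  have hsub : Ici t₀ ⊆ Ici (0 : ℝ) := Ici_subset_Ici.2 ht₀
  have hΨc : ContinuousOn Ψ (Ici t₀) := fun s hs =>
    ((hΨ s (hsub hs)).mono hsub).continuousWithinAt
  have hz : ∀ s, t₀ ≤ s → HasDerivWithinAt (fun s => Ψ s (x s)) (Ψ s (g s)) (Ici t₀) s :=
    fun s hs => by
      refine (((hΨ s (ht₀.trans hs)).mono hsub).clm_apply (hx s hs)).congr_deriv ?_
      simp
  have hΨg : ContinuousOn (fun s => Ψ s (g s)) (Icc t₀ t) :=
    (hΨc.clm_apply hg).mono Icc_subset_Ici_self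
  have hint : ∫ s in t₀..t, Ψ s (g s) = Ψ t (x t) - Ψ t₀ (x t₀) :=
    intervalIntegral.integral_eq_sub_of_hasDeriv_right_of_le (f := fun s => Ψ s (x s)) ht
      (fun s hs => ((hz s hs.1).continuousWithinAt).mono Icc_subset_Ici_self)
      (fun s hs => (hz s hs.1.le).mono (fun r hr => hs.1.le.trans (le_of_lt hr)))
      (hΨg.intervalIntegrable_of_Icc ht)
  have hxt : x t = (Φ t).comp (Ψ t₀) (x t₀) + ∫ s in t₀..t, (Φ t).comp (Ψ s) (g s) := by
    have h1 : ∫ s in t₀..t, (Φ t).comp (Ψ s) (g s) = Φ t (∫ s in t₀..t, Ψ s (g s)) :=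
      (Φ t).intervalIntegral_comp_comm (hΨg.intervalIntegrable_of_Icc ht)
    have h2 : Φ t (Ψ t (x t)) = x t :=
      congrArg (fun T : V →L[ℝ] V => T (x t)) (hΦΨ t (ht₀.trans ht))
    rw [h1, hint, map_sub, h2]
    simp
  rw [hxt]
  refine (norm_add_le _ _).trans (add_le_add ?_ ?_)
  · exact ((Φ t).comp (Ψ t₀)).le_of_opNorm_le (hR t₀ le_rfl ht) _
  · refine intervalIntegral.norm_integral_le_of_norm_le ht ?_ ?_
    · refine Filter.Eventually.of_forall fun s hs => ?_
      exact ((Φ t).comp (Ψ s)).le_of_opNorm_le (hR s hs.1.le hs.2) _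
    · refine ContinuousOn.intervalIntegrable_of_Icc ht ?_
      exact (by fun_prop : ContinuousOn (fun s => c * Real.exp (-γ * (t - s))) _).mul
        (hg.norm.mono Icc_subset_Ici_self)

end Linear

/-! ### Grönwall's inequality and integrals of `L^p` functions. -/

section Gronwall

lemma hasDerivWithinAt_integral_Ici {g : ℝ → ℝ} {a : ℝ} (hg : ContinuousOn g (Ici a)) {t : ℝ}
    (ht : a ≤ t) : HasDerivWithinAt (fun t => ∫ s in a..t, g s) (g t) (Ici a) t := by
  -- Freezing `g` to the left of `a` makes it continuous on all of `ℝ`, so the two-sided fundamental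
  -- theorem applies even at `a`.
  have hc : Continuous fun s => g (max s a) :=
    hg.comp_continuous (by fun_prop) fun s => le_max_right s a
  have h := (intervalIntegral.integral_hasDerivAt_right (hc.intervalIntegrable a t)
    (hc.stronglyMeasurableAtFilter _ _) hc.continuousAt).hasDerivWithinAt (s := Ici a)
  have heq : ∀ u, a ≤ u → ∫ s in a..u, g s = ∫ s in a..u, g (max s a) := fun u hu =>
    intervalIntegral.integral_congr fun s hs => by
      rw [uIcc_of_le hu] at hs
      simp only [max_eq_left hs.1]
  rw [max_eq_left ht] at h
  exact h.congr heq (heq t ht)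

/-- Grönwall's inequality in integral form with variable coefficients. -/
lemma le_mul_exp_of_le_integral {u b q : ℝ → ℝ} {a m t₀ : ℝ}
    (hu : ContinuousOn u (Ici t₀)) (hb : ContinuousOn b (Ici t₀)) (hq : ContinuousOn q (Ici t₀))
    (hb0 : ∀ t, t₀ ≤ t → 0 ≤ b t)
    (hle : ∀ t, t₀ ≤ t → u t ≤ a + ∫ s in t₀..t, (b s * u s + q s))
    (hqm : ∀ t, t₀ ≤ t → q t ≤ m * Real.exp (∫ s in t₀..t, b s)) {t : ℝ} (ht : t₀ ≤ t) :
    u t ≤ (a + m * (t - t₀)) * Real.exp (∫ s in t₀..t, b s) := by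
  set B : ℝ → ℝ := fun t => ∫ s in t₀..t, b s with hB
  set v : ℝ → ℝ := fun t => a + ∫ s in t₀..t, (b s * u s + q s) with hv
  have hBd : ∀ s, t₀ ≤ s → HasDerivWithinAt B (b s) (Ici t₀) s := fun s hs =>
    hasDerivWithinAt_integral_Ici hb hs
  have hvd : ∀ s, t₀ ≤ s → HasDerivWithinAt v (b s * u s + q s) (Ici t₀) s := fun s hs =>
    (hasDerivWithinAt_integral_Ici ((hb.mul hu).add hq) hs).const_add a
  -- The integrating factor `e^{-B}` removes the term `b u`; what remains of `q` is at most `m`,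
  -- which the linear term compensates.
  set w : ℝ → ℝ := fun s => v s * Real.exp (-B s) - m * (s - t₀) with hw
  have hwd : ∀ s, t₀ ≤ s → HasDerivWithinAt w ((b s * u s + q s) * Real.exp (-B s) +
      v s * (Real.exp (-B s) * -b s) - m * 1) (Ici t₀) s := fun s hs =>
    ((hvd s hs).mul (hBd s hs).neg.exp).sub
      (((hasDerivWithinAt_id s _).sub_const t₀).const_mul m)
  have hanti : AntitoneOn w (Ici t₀) := by
    refine antitoneOn_of_hasDerivWithinAt_nonpos (convex_Ici t₀)
      (fun s hs => (hwd s hs).continuousWithinAt)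
      (fun s hs => (hwd s (interior_subset hs)).mono interior_subset) fun s hs => ?_
    have hs' : t₀ ≤ s := interior_subset hs
    have h1 : b s * u s ≤ b s * v s := mul_le_mul_of_nonneg_left (hle s hs') (hb0 s hs')
    have h2 : q s * Real.exp (-B s) ≤ m := by
      rw [Real.exp_neg, ← div_eq_mul_inv, div_le_iff₀ (Real.exp_pos _)]
      exact hqm s hs'
    have h3 := mul_le_mul_of_nonneg_right h1 (Real.exp_pos (-B s)).le
    linarith
  have h := hanti self_mem_Ici ht ht
  have hwt₀ : w t₀ = a := by simp [hw, hv, hB]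
  have h2 : v t * Real.exp (-B t) ≤ a + m * (t - t₀) := by
    rw [hwt₀] at h
    simp only [hw] at h
    linarith
  rw [Real.exp_neg, ← div_eq_mul_inv, div_le_iff₀ (Real.exp_pos _)] at h2
  exact (hle t ht).trans h2

/-- The integral of an `L^p` function, `1 ≤ p < ∞`, grows slower than any linear function. -/
lemma exists_integral_le_mul_add_of_memLp {φ : ℝ → ℝ} (hφ : ContinuousOn φ (Ici 0))
    (hφ0 : ∀ t, 0 ≤ t → 0 ≤ φ t) {p : ℝ≥0∞} (hp : 1 ≤ p) (hp_top : p ≠ ∞)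
    (hφp : MemLp φ p (volume.restrict (Ici 0))) {η : ℝ} (hη : 0 < η) :
    ∃ C : ℝ, ∀ t₀ t, 0 ≤ t₀ → t₀ ≤ t → ∫ s in t₀..t, φ s ≤ η * (t - t₀) + C := by
  set q : ℝ := p.toReal with hq
  have hq1 : 1 ≤ q := by
    rw [hq, ← ENNReal.toReal_one]
    exact ENNReal.toReal_mono hp_top hp
  have hint : IntegrableOn (fun t => ‖φ t‖ ^ q) (Ici 0) :=
    hφp.integrable_norm_rpow (zero_lt_one.trans_le hp).ne' hp_top
  refine ⟨η ^ (1 - q) * ∫ t in Ici 0, ‖φ t‖ ^ q, fun t₀ t ht₀ ht => ?_⟩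
  have hsub : Icc t₀ t ⊆ Ici (0 : ℝ) := fun s hs => ht₀.trans hs.1
  -- Where `φ > η`, the nonpositive exponent `1 - q` gives `φ = φ^{1-q} φ^q ≤ η^{1-q} φ^q`.
  have hpt : ∀ s ∈ Icc t₀ t, φ s ≤ η + η ^ (1 - q) * ‖φ s‖ ^ q := fun s hs => by
    have hs0 := hφ0 s (hsub hs)
    rw [Real.norm_eq_abs, abs_of_nonneg hs0]
    rcases le_total (φ s) η with h | h
    · exact h.trans (le_add_of_nonneg_right (by positivity))
    · have hpos : 0 < φ s := hη.trans_le h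
      refine le_add_of_nonneg_of_le hη.le ?_
      have h1 : φ s ^ (1 - q) ≤ η ^ (1 - q) :=
        Real.rpow_le_rpow_of_nonpos hη h (by linarith)
      calc φ s = φ s ^ (1 - q) * φ s ^ q := by
            rw [← Real.rpow_add hpos, sub_add_cancel, Real.rpow_one]
        _ ≤ _ := by gcongr
  have hI : IntervalIntegrable (fun s => ‖φ s‖ ^ q) volume t₀ t :=
    (intervalIntegrable_iff_integrableOn_Icc_of_le ht).2 (hint.mono_set hsub)
  calc ∫ s in t₀..t, φ s ≤ ∫ s in t₀..t, (η + η ^ (1 - q) * ‖φ s‖ ^ q) :=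
        intervalIntegral.integral_mono_on ht ((hφ.mono hsub).intervalIntegrable_of_Icc ht)
          (intervalIntegrable_const.add (hI.const_mul _)) hpt
    _ = η * (t - t₀) + η ^ (1 - q) * ∫ s in t₀..t, ‖φ s‖ ^ q := by
        rw [intervalIntegral.integral_add intervalIntegrable_const (hI.const_mul _),
          intervalIntegral.integral_const, intervalIntegral.integral_const_mul, smul_eq_mul,
          mul_comm (t - t₀)]
    _ ≤ _ := by
        gcongr
        rw [intervalIntegral.integral_of_le ht]
        exact setIntegral_mono_set hint (ae_of_all _ fun s => by positivity)
          (Filter.Eventually.of_forall (Ioc_subset_Icc_self.trans hsub))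

end Gronwall

/-! ### Maximal solutions. -/

section Maximal

variable {V : Type*} [NormedAddCommGroup V] [NormedSpace ℝ V]

lemma IsSolutionOn.eqOn {f : ℝ → V → V} {t₀ : ℝ} {x₀ : V}
    (hlip : ∀ T r : ℝ, ∃ K : ℝ≥0, ∀ t ∈ Icc t₀ T, LipschitzOnWith K (f t) (Metric.closedBall 0 r))
    {I J : Set ℝ} {x y : ℝ → V} (hx : IsSolutionOn f t₀ x₀ I x) (hy : IsSolutionOn f t₀ x₀ J y)
    (hIJ : I ⊆ J) : EqOn y x I := by
  intro t ht
  have hI : Icc t₀ t ⊆ I := hx.1.out hx.2.1.1 ht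
  refine eqOn_Icc_of_lipschitzOnWith_closedBall (hlip t)
    (fun s hs => (hy.2.2.2 s (hIJ (hI hs))).mono (hI.trans hIJ))
    (fun s hs => (hx.2.2.2 s (hI hs)).mono hI) (hy.2.2.1.trans hx.2.2.1.symm)
    ⟨hx.2.1.2 ht, le_rfl⟩

lemma IsSolutionOn.subset_Ici {f : ℝ → V → V} {t₀ : ℝ} {x₀ : V} {I : Set ℝ} {x : ℝ → V}
    (hx : IsSolutionOn f t₀ x₀ I x) : I ⊆ Ici t₀ := fun _ ht => hx.2.1.2 ht

lemma IsSolutionOn.isMaximalSolution_Ici {f : ℝ → V → V} {t₀ : ℝ} {x₀ : V} {x : ℝ → V}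
    (hx : IsSolutionOn f t₀ x₀ (Ici t₀) x) : IsMaximalSolution f t₀ x₀ (Ici t₀) x :=
  ⟨hx, fun _ _ hy hJ _ => hy.subset_Ici.antisymm hJ⟩

/-- Every maximal solution agrees with a given global one. -/
lemma IsMaximalSolution.eq_of_isSolutionOn_Ici {f : ℝ → V → V} {t₀ : ℝ} {x₀ : V}
    (hlip : ∀ T r : ℝ, ∃ K : ℝ≥0, ∀ t ∈ Icc t₀ T, LipschitzOnWith K (f t) (Metric.closedBall 0 r))
    {J : Set ℝ} {x y : ℝ → V} (hy : IsMaximalSolution f t₀ x₀ J y)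
    (hx : IsSolutionOn f t₀ x₀ (Ici t₀) x) : J = Ici t₀ ∧ EqOn y x (Ici t₀) := by
  have hxy : EqOn x y J := hy.1.eqOn hlip hx hy.1.subset_Ici
  have hJ := hy.2 _ x hx hy.1.subset_Ici hxy
  exact ⟨hJ.symm, hJ ▸ hxy.symm⟩

lemma exists_isSolutionOn_Ici [CompleteSpace V] {f : ℝ → V → V} {t₀ : ℝ}
    (hlip : ∀ T r : ℝ, ∃ K : ℝ≥0, ∀ t ∈ Icc t₀ T, LipschitzOnWith K (f t) (Metric.closedBall 0 r))
    (hcont : ∀ x, ContinuousOn (fun t => f t x) (Ici t₀))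
    (hgrowth : ∀ T : ℝ, ∃ α β : ℝ, 0 ≤ α ∧ 0 ≤ β ∧
      ∀ t ∈ Icc t₀ T, ∀ x, ‖f t x‖ ≤ α * ‖x‖ + β) (x₀ : V) :
    ∃ x : ℝ → V, IsSolutionOn f t₀ x₀ (Ici t₀) x := by
  obtain ⟨x, hx0, hx⟩ := exists_hasDerivWithinAt_Ici_of_linear_growth hlip hcont hgrowth x₀
  exact ⟨x, ordConnected_Ici, isLeast_Ici, hx0, hx⟩

end Maximal

/-! ### Perturbations of a stable linear system. -/

section Perturbation

variable {V : Type*} [NormedAddCommGroup V] [NormedSpace ℝ V] [FiniteDimensional ℝ V]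

/-- A perturbation that is locally Lipschitz uniformly in time is Lipschitz on balls, with the same
constant for all times of a compact interval. -/
lemma LocallyLipschitzUniformlyInTime.exists_lipschitzOnWith {E : Set ℝ} {h : ℝ → V → ℝ → V}
    (hlip : LocallyLipschitzUniformlyInTime E h) {ε : ℝ} (hε : ε ∈ E)
    (hcont : ∀ x, ContinuousOn (fun t => h t x ε) (Ici 0)) (T r : ℝ) :
    ∃ K : ℝ≥0, ∀ t ∈ Icc 0 T, LipschitzOnWith K (fun x => h t x ε) (Metric.closedBall 0 r) := by
  have : ProperSpace V := FiniteDimensional.proper_real V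
  -- As a map into `C([0, T], V)` with the sup norm, `G` turns uniformity in time into a plain local
  -- Lipschitz condition, which compactness of the ball makes global.
  let G : V → C(Icc (0 : ℝ) T, V) := fun x =>
    ⟨fun t => h t x ε, ((hcont x).mono Icc_subset_Ici_self).domRestrict⟩
  have hG : LocallyLipschitzOn (Metric.closedBall 0 r) G := fun x _ => by
    obtain ⟨K, U, hU, hK⟩ := hlip x ε hε
    have htend : Filter.Tendsto (fun y : V => (y, ε)) (𝓝 x) (𝓝[univ ×ˢ E] (x, ε)) :=
      tendsto_nhdsWithin_iff.2 ⟨(by fun_prop : Continuous fun y : V => (y, ε)).tendsto x,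
        Filter.Eventually.of_forall fun y => ⟨mem_univ y, hε⟩⟩
    refine ⟨K, (fun y => (y, ε)) ⁻¹' U, mem_nhdsWithin_of_mem_nhds (htend hU), ?_⟩
    refine LipschitzOnWith.of_dist_le_mul fun y hy z hz => ?_
    refine (ContinuousMap.dist_le (by positivity)).2 fun t => ?_
    have h1 := (hK t t.2.1).dist_le_mul _ hy _ hz
    rwa [dist_prod_same_right] at h1
  obtain ⟨K, hK⟩ := hG.exists_lipschitzOnWith_of_compact (isCompact_closedBall 0 r)
  refine ⟨K, fun t ht => LipschitzOnWith.of_dist_le_mul fun y hy z hz => ?_⟩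
  exact (ContinuousMap.dist_apply_le_dist (f := G y) (g := G z) ⟨t, ht⟩).trans
    (hK.dist_le_mul y hy z hz)

/-- Global existence for a linear system with a perturbation of linear growth, together with
Lipschitz bounds for the vector field. -/
lemma lipschitz_and_exists_isSolutionOn_Ici {A : ℝ → V →L[ℝ] V} {g : ℝ → V → V} {φ lam : ℝ → ℝ}
    (hA : ContinuousOn A (Ici 0))
    (hlip : ∀ T r : ℝ, ∃ K : ℝ≥0, ∀ t ∈ Icc 0 T, LipschitzOnWith K (g t) (Metric.closedBall 0 r))
    (hcont : ∀ x, ContinuousOn (fun t => g t x) (Ici 0))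
    (hφ : ContinuousOn φ (Ici 0)) (hlam : ContinuousOn lam (Ici 0))
    (hbound : ∀ t, 0 ≤ t → ∀ x, ‖g t x‖ ≤ φ t * ‖x‖ + lam t) {t₀ : ℝ} (ht₀ : 0 ≤ t₀) :
    (∀ T r : ℝ, ∃ K : ℝ≥0, ∀ t ∈ Icc t₀ T,
      LipschitzOnWith K (fun x => A t x + g t x) (Metric.closedBall 0 r)) ∧
    ∀ x₀, ∃ x : ℝ → V, IsSolutionOn (fun t x => A t x + g t x) t₀ x₀ (Ici t₀) x := by
  have : CompleteSpace V := FiniteDimensional.complete ℝ V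
  have hsub : ∀ T, Icc t₀ T ⊆ Icc 0 T := fun T => Icc_subset_Icc_left ht₀
  have hsub' : ∀ T : ℝ, Icc 0 T ⊆ Ici 0 := fun T => Icc_subset_Ici_self
  have hAbd : ∀ T : ℝ, ∃ C : ℝ≥0, ∀ t ∈ Icc 0 T, ‖A t‖ ≤ C := fun T => by
    obtain ⟨C, hC⟩ := isCompact_Icc.exists_bound_of_continuousOn (hA.mono (hsub' T))
    exact ⟨C.toNNReal, fun t ht => (hC t ht).trans (Real.le_coe_toNNReal C)⟩
  have hL : ∀ T r : ℝ, ∃ K : ℝ≥0, ∀ t ∈ Icc t₀ T,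
      LipschitzOnWith K (fun x => A t x + g t x) (Metric.closedBall 0 r) := fun T r => by
    obtain ⟨C, hC⟩ := hAbd T
    obtain ⟨K, hK⟩ := hlip T r
    exact ⟨C + K, fun t ht => (((A t).lipschitz.weaken (hC t (hsub T ht))).lipschitzOnWith).add
      (hK t (hsub T ht))⟩
  refine ⟨hL, fun x₀ => exists_isSolutionOn_Ici hL (fun x => ?_) (fun T => ?_) x₀⟩
  · exact ((hA.clm_apply continuousOn_const).add (hcont x)).mono (Ici_subset_Ici.2 ht₀)
  · obtain ⟨C, hC⟩ := hAbd T
    obtain ⟨a, ha⟩ := isCompact_Icc.exists_bound_of_continuousOn (hφ.mono (hsub' T))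
    obtain ⟨b, hb⟩ := isCompact_Icc.exists_bound_of_continuousOn (hlam.mono (hsub' T))
    refine ⟨C + |a|, |b|, by positivity, by positivity, fun t ht x => ?_⟩
    have ht' := hsub T ht
    have h1 := (A t).le_of_opNorm_le (hC t ht') x
    have h2 := hbound t ht'.1 x
    have h3 : φ t ≤ |a| := (Real.le_norm_self _).trans ((ha t ht').trans (le_abs_self a))
    have h4 : lam t ≤ |b| := (Real.le_norm_self _).trans ((hb t ht').trans (le_abs_self b))
    have h5 := mul_le_mul_of_nonneg_right h3 (norm_nonneg x)
    have h6 := norm_add_le (A t x) (g t x)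
    linarith

/-- Exponential decay of solutions of `x' = A x + g` when `A` is exponentially stable and `g` is
bounded by `(κ + φ) ‖x‖ + lam` with `φ` of slow integral growth and `lam` decaying. -/
lemma GloballyUniformlyExpStable.norm_le_of_perturbation {A : ℝ → V →L[ℝ] V} {c γ κ η C M : ℝ}
    (hstab : GloballyUniformlyExpStable A c γ) (hA : ContinuousOn A (Ici 0)) (hκ : 0 ≤ κ)
    (hη : 0 < η) (hM : 0 ≤ M) {φ lam : ℝ → ℝ}
    (hφ : ContinuousOn φ (Ici 0)) (hφ0 : ∀ t, 0 ≤ t → 0 ≤ φ t) (hlam : ContinuousOn lam (Ici 0))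
    {t₀ : ℝ} (ht₀ : 0 ≤ t₀)
    (hφint : ∀ t, t₀ ≤ t → c * ∫ s in t₀..t, φ s ≤ η * (t - t₀) + C)
    (hdecay : ∀ t, 0 ≤ t → lam t ≤ M * Real.exp (-(γ - κ * c) * t))
    {x g : ℝ → V} (hg : ContinuousOn g (Ici t₀))
    (hbound : ∀ t, t₀ ≤ t → ‖g t‖ ≤ (κ + φ t) * ‖x t‖ + lam t)
    (hx : ∀ t, t₀ ≤ t → HasDerivWithinAt x (A t (x t) + g t) (Ici t₀) t) {t : ℝ} (ht : t₀ ≤ t) :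
    ‖x t‖ ≤ c * Real.exp C * ‖x t₀‖ * Real.exp (-(γ - κ * c - η) * (t - t₀)) +
      c * M * Real.exp C / η * Real.exp (-(γ - κ * c - 2 * η) * t) := by
  have hc : 0 < c := hstab.1
  have hsub : Ici t₀ ⊆ Ici (0 : ℝ) := Ici_subset_Ici.2 ht₀
  have hφ' := hφ.mono hsub
  have hlam' := hlam.mono hsub
  have hxc : ContinuousOn x (Ici t₀) := fun s hs => (hx s hs).continuousWithinAt
  have hec : ContinuousOn (fun s => Real.exp (γ * s)) (Ici t₀) := by fun_prop
  have huc : ContinuousOn (fun s => Real.exp (γ * s) * ‖x s‖) (Ici t₀) := hec.mul hxc.norm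
  have hbc : ContinuousOn (fun s => c * (κ + φ s)) (Ici t₀) :=
    continuousOn_const.mul (continuousOn_const.add hφ')
  have hqc : ContinuousOn (fun s => c * Real.exp (γ * s) * lam s) (Ici t₀) :=
    (continuousOn_const.mul hec).mul hlam'
  have hB : ∀ s, t₀ ≤ s → ∫ r in t₀..s, c * (κ + φ r) =
      κ * c * (s - t₀) + c * ∫ r in t₀..s, φ r := fun s hs => by
    rw [intervalIntegral.integral_const_mul, intervalIntegral.integral_add
      intervalIntegrable_const ((hφ'.mono Icc_subset_Ici_self).intervalIntegrable_of_Icc hs),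
      intervalIntegral.integral_const, smul_eq_mul]
    ring
  -- `m` is chosen so that `c e^{γ s} lam(s) ≤ c M e^{κ c s} = m e^{κ c (s - t₀)}`, which is at most
  -- `m e^{∫ b}` as `φ ≥ 0`.
  have hgron := le_mul_exp_of_le_integral (a := c * Real.exp (γ * t₀) * ‖x t₀‖)
    (m := c * M * Real.exp (κ * c * t₀)) huc hbc hqc
    (fun s hs => mul_nonneg hc.le (add_nonneg hκ (hφ0 s (hsub hs)))) (fun s hs => ?_)
    (fun s hs => ?_) ht
  · rw [hB t ht] at hgron
    have hexpB : Real.exp (κ * c * (t - t₀) + c * ∫ r in t₀..t, φ r) ≤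
        Real.exp (κ * c * (t - t₀) + (η * (t - t₀) + C)) := by
      gcongr
      exact hφint t ht
    -- The resonant factor `t - t₀` is traded for `e^{η (t - t₀)} / η`, the source of `2 η` and of
    -- the division by `η` in the bound.
    have hlin : t - t₀ ≤ Real.exp (η * (t - t₀)) / η := by
      rw [le_div_iff₀ hη]
      linarith [Real.add_one_le_exp (η * (t - t₀))]
    have hηt : Real.exp (-(γ - κ * c - 2 * η) * t - 2 * η * t₀) ≤
        Real.exp (-(γ - κ * c - 2 * η) * t) := by
      gcongr
      have : 0 ≤ 2 * η * t₀ := by positivity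
      linarith
    have hnn : 0 ≤ t - t₀ := sub_nonneg.2 ht
    calc ‖x t‖ = Real.exp (-γ * t) * (Real.exp (γ * t) * ‖x t‖) := by
          rw [← mul_assoc, ← Real.exp_add]; simp
      _ ≤ Real.exp (-γ * t) * ((c * Real.exp (γ * t₀) * ‖x t₀‖ +
            c * M * Real.exp (κ * c * t₀) * (t - t₀)) *
            Real.exp (κ * c * (t - t₀) + (η * (t - t₀) + C))) := by
          refine mul_le_mul_of_nonneg_left (hgron.trans ?_) (Real.exp_pos _).le
          refine mul_le_mul_of_nonneg_left hexpB ?_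
          positivity
      _ ≤ Real.exp (-γ * t) * ((c * Real.exp (γ * t₀) * ‖x t₀‖ +
            c * M * Real.exp (κ * c * t₀) * (Real.exp (η * (t - t₀)) / η)) *
            Real.exp (κ * c * (t - t₀) + (η * (t - t₀) + C))) := by
          gcongr
      _ = c * Real.exp C * ‖x t₀‖ * Real.exp (-(γ - κ * c - η) * (t - t₀)) +
            c * M * Real.exp C / η * Real.exp (-(γ - κ * c - 2 * η) * t - 2 * η * t₀) := by
          have e1 : Real.exp C * Real.exp (-(γ - κ * c - η) * (t - t₀)) = Real.exp (-γ * t) *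
              Real.exp (γ * t₀) * Real.exp (κ * c * (t - t₀) + (η * (t - t₀) + C)) := by
            simp only [← Real.exp_add]; congr 1; ring
          have e2 : Real.exp C * Real.exp (-(γ - κ * c - 2 * η) * t - 2 * η * t₀) =
              Real.exp (-γ * t) * Real.exp (κ * c * t₀) * Real.exp (η * (t - t₀)) *
              Real.exp (κ * c * (t - t₀) + (η * (t - t₀) + C)) := by
            simp only [← Real.exp_add]; congr 1; ring
          linear_combination (-c * ‖x t₀‖) * e1 - c * M / η * e2
      _ ≤ _ := by gcongr
  · have h := hstab.norm_le hA ht₀ hg hx hs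
    have hmono : ∫ r in t₀..s, Real.exp (γ * s) * (c * Real.exp (-γ * (s - r)) * ‖g r‖) ≤
        ∫ r in t₀..s, (c * (κ + φ r) * (Real.exp (γ * r) * ‖x r‖) +
          c * Real.exp (γ * r) * lam r) := by
      refine intervalIntegral.integral_mono_on hs
        (ContinuousOn.intervalIntegrable_of_Icc hs ?_)
        ((((hbc.mul huc).add hqc).mono Icc_subset_Ici_self).intervalIntegrable_of_Icc hs)
        fun r hr => ?_
      · exact continuousOn_const.mul
          ((by fun_prop : ContinuousOn (fun r => c * Real.exp (-γ * (s - r))) _).mul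
            (hg.norm.mono Icc_subset_Ici_self))
      · have h1 : Real.exp (γ * s) * (c * Real.exp (-γ * (s - r)) * ‖g r‖) =
            c * Real.exp (γ * r) * ‖g r‖ := by
          have : Real.exp (γ * s) * Real.exp (-γ * (s - r)) = Real.exp (γ * r) := by
            rw [← Real.exp_add]; congr 1; ring
          rw [← this]; ring
        rw [h1]
        refine (mul_le_mul_of_nonneg_left (hbound r hr.1) (by positivity)).trans (le_of_eq ?_)
        ring
    rw [intervalIntegral.integral_const_mul] at hmono
    have h2 := mul_le_mul_of_nonneg_left h (Real.exp_pos (γ * s)).le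
    have h3 : Real.exp (γ * s) * Real.exp (-γ * (s - t₀)) = Real.exp (γ * t₀) := by
      rw [← Real.exp_add]; congr 1; ring
    refine h2.trans ?_
    rw [mul_add, ← h3]
    refine add_le_add (le_of_eq (by ring)) hmono
  · have hs0 : 0 ≤ s := hsub hs
    have hφI : 0 ≤ ∫ r in t₀..s, φ r :=
      intervalIntegral.integral_nonneg hs fun r hr => hφ0 r (ht₀.trans hr.1)
    rw [hB s hs]
    calc c * Real.exp (γ * s) * lam s
        ≤ c * Real.exp (γ * s) * (M * Real.exp (-(γ - κ * c) * s)) := by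
          gcongr
          exact hdecay s hs0
      _ = c * M * Real.exp (κ * c * t₀) * Real.exp (κ * c * (s - t₀) + 0) := by
          have : Real.exp (γ * s) * Real.exp (-(γ - κ * c) * s) =
              Real.exp (κ * c * t₀) * Real.exp (κ * c * (s - t₀) + 0) := by
            simp only [← Real.exp_add]; congr 1; ring
          linear_combination c * M * this
      _ ≤ _ := by
          gcongr
          positivity

end Perturbation

/-! ### The main theorem. -/

theorem theorem2 {V : Type*} [NormedAddCommGroup V] [NormedSpace ℝ V] [FiniteDimensional ℝ V]
    -- the linear part `A₀ + ε F`
    (A₀ F : ℝ → V →L[ℝ] V)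
    (hA₀ : ContinuousOn A₀ (Ici 0)) (hF : ContinuousOn F (Ici 0))
    (k : ℝ) (hk : IsLUB ((fun t => ‖F t‖) '' Ici 0) k)
    (c γ : ℝ) (hstab : GloballyUniformlyExpStable A₀ c γ)
    -- the set of parameters for which `h` is defined
    (E : Set ℝ) (hE : E ⊆ Ici 0)
    -- the nonlinear part
    (h : ℝ → V → ℝ → V)
    (hcont : ContinuousOn (fun q : ℝ × V × ℝ => h q.1 q.2.1 q.2.2) (Ici 0 ×ˢ univ ×ˢ E))
    (hlip : LocallyLipschitzUniformlyInTime E h)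
    (φ : ℝ → ℝ) (hφ : ContinuousOn φ (Ici 0)) (hφ_nonneg : ∀ t, 0 ≤ t → 0 ≤ φ t)
    (lam : ℝ → ℝ → ℝ) (hlam : ∀ ε ∈ E, ContinuousOn (lam ε) (Ici 0))
    (hlam_nonneg : ∀ ε ∈ E, ∀ t, 0 ≤ t → 0 ≤ lam ε t)
    (hbound : ∀ ε ∈ E, ∀ t, 0 ≤ t → ∀ x : V, ‖h t x ε‖ ≤ φ t * ‖x‖ + lam ε t)
    (p : ℝ≥0∞) (hp : 1 ≤ p) (hp_top : p ≠ ∞) (hφp : MemLp φ p (volume.restrict (Ici 0)))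
    (hdecay : ∀ ε ∈ E, ∃ M' : ℝ, 0 < M' ∧
      ∀ t, 0 ≤ t → lam ε t ≤ M' * Real.exp (-(γ - k * c * ε) * t)) :
    ∀ ε ∈ E, k * c * ε < γ →
      ∃ L N δ θ : ℝ, 0 ≤ L ∧ 0 ≤ N ∧
        δ ∈ Ioc 0 (γ - k * c * ε) ∧ θ ∈ Ioc 0 (γ - k * c * ε) ∧
        ∀ t₀ : ℝ, 0 ≤ t₀ → ∀ x₀ : V,
          -- there is exactly one maximal solution
          (∃ (I : Set ℝ) (x : ℝ → V),
            IsMaximalSolution (fun t y => (A₀ t + ε • F t) y + h t y ε) t₀ x₀ I x ∧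
            ∀ (J : Set ℝ) (y : ℝ → V),
              IsMaximalSolution (fun t y => (A₀ t + ε • F t) y + h t y ε) t₀ x₀ J y →
                J = I ∧ EqOn y x I) ∧
          -- it is global and satisfies the estimate
          ∀ (I : Set ℝ) (x : ℝ → V),
            IsMaximalSolution (fun t y => (A₀ t + ε • F t) y + h t y ε) t₀ x₀ I x →
              I = Ici t₀ ∧
              ∀ t, t₀ ≤ t →
                ‖x t‖ ≤ L * ‖x₀‖ * Real.exp (-δ * (t - t₀)) + N * Real.exp (-θ * t) := by
  intro ε hε hεγ
  have hc : 0 < c := hstab.1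
  have hε0 : 0 ≤ ε := hE hε
  have hFk : ∀ t, 0 ≤ t → ‖F t‖ ≤ k := fun t ht => hk.1 ⟨t, ht, rfl⟩
  have hk0 : 0 ≤ k := (norm_nonneg _).trans (hFk 0 le_rfl)
  obtain ⟨M, hM, hMdecay⟩ := hdecay ε hε
  set Γ : ℝ := γ - k * c * ε with hΓ
  have hΓ0 : 0 < Γ := sub_pos.2 hεγ
  -- Any `η` in `(0, Γ / 2)` keeps `Γ - 2 η` positive. The integral of `φ` enters multiplied by `c`,
  -- hence the slope `η / c` below.
  set η : ℝ := Γ / 4 with hη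
  have hη0 : 0 < η := by positivity
  obtain ⟨C, hC⟩ := exists_integral_le_mul_add_of_memLp hφ hφ_nonneg hp hp_top hφp
    (div_pos hη0 hc)
  have hhc : ContinuousOn (fun q : ℝ × V => h q.1 q.2 ε) (Ici 0 ×ˢ univ) :=
    hcont.comp (f := fun q : ℝ × V => (q.1, q.2, ε)) (by fun_prop)
      fun q hq => ⟨hq.1, mem_univ _, hε⟩
  have hhx : ∀ x, ContinuousOn (fun t => h t x ε) (Ici 0) := fun x =>
    hhc.comp (f := fun t => (t, x)) (by fun_prop) fun t ht => ⟨ht, mem_univ _⟩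
  have hA : ContinuousOn (fun t => A₀ t + ε • F t) (Ici 0) := hA₀.add (hF.const_smul ε)
  refine ⟨c * Real.exp (c * C), c * M * Real.exp (c * C) / η, Γ - η, Γ - 2 * η, by positivity,
    by positivity, ⟨by linarith, by linarith⟩, ⟨by linarith, by linarith⟩, fun t₀ ht₀ x₀ => ?_⟩
  obtain ⟨hL, hsol⟩ := lipschitz_and_exists_isSolutionOn_Ici hA
    (hlip.exists_lipschitzOnWith hε hhx) hhx hφ (hlam ε hε) (hbound ε hε) ht₀
  obtain ⟨z, hz⟩ := hsol x₀
  refine ⟨⟨Ici t₀, z, hz.isMaximalSolution_Ici, fun J y hy => hy.eq_of_isSolutionOn_Ici hL hz⟩,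
    fun I x hx => ?_⟩
  obtain rfl : I = Ici t₀ := (hx.eq_of_isSolutionOn_Ici hL hz).1
  refine ⟨rfl, fun t ht => ?_⟩
  obtain ⟨-, -, hx0, hxd⟩ := hx.1
  have hsub : Ici t₀ ⊆ Ici (0 : ℝ) := Ici_subset_Ici.2 ht₀
  have hxc : ContinuousOn x (Ici t₀) := fun s hs => (hxd s hs).continuousWithinAt
  have hΓκ : γ - ε * k * c = Γ := by rw [hΓ]; ring
  -- The term `ε F x` is moved into the perturbation `g`, where it contributes `κ = ε k`.
  have key := hstab.norm_le_of_perturbation hA₀ (κ := ε * k) (η := η) (C := c * C) (M := M)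
    (φ := φ) (lam := lam ε) (x := x) (g := fun s => ε • F s (x s) + h s (x s) ε)
    (by positivity) hη0 hM.le hφ hφ_nonneg (hlam ε hε) ht₀
    (fun s hs => ?_) (by rwa [hΓκ]) ?_ (fun s hs => ?_) (fun s hs => ?_) ht
  · rwa [hΓκ, hx0] at key
  · refine (mul_le_mul_of_nonneg_left (hC t₀ s ht₀ hs) hc.le).trans (le_of_eq ?_)
    field_simp
  · exact (((hF.mono hsub).clm_apply hxc).const_smul ε).add
      (hhc.comp (f := fun s => (s, x s)) (continuousOn_id.prodMk hxc)
        fun s hs => ⟨hsub hs, mem_univ _⟩)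
  · have h1 : ‖ε • F s (x s)‖ ≤ ε * (k * ‖x s‖) := by
      rw [norm_smul, Real.norm_eq_abs, abs_of_nonneg hε0]
      exact mul_le_mul_of_nonneg_left ((F s).le_of_opNorm_le (hFk s (hsub hs)) _) hε0
    have h2 := hbound ε hε s (hsub hs) (x s)
    refine (norm_add_le _ _).trans ?_
    linarith
  · refine (hxd s hs).congr_deriv ?_
    simp [add_assoc]
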